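/- Let $n\ge 1$, $k\in\{0,1,2,\dots\}$, $\lambda\in\mathbb{C}$, and $r(x)=\|x\|$ (Euclidean norm) on $\mathbb{R}^n\setminus\{0\}$. Let $\mathcal{D}'(\mathbb{R}^n\setminus\{0\})$ be the space of complex-valued distributions on $\mathbb{R}^n\setminus\{0\}$. For $a>0$ let $U_a$ be the dilation operator $U_af(x)=f(ax)$ on this space, i.e. $\langle U_af,\varphi\rangle=a^{-n}\langle f,\varphi(\cdot/a)\rangle$ for all test functions $\varphi$, and let $$S_k(\lambda)=\bigcap_{a>0}\ker\,(U_a-a^\lambda I)^{k+1}\subseteq \mathcal{D}'(\mathbb{R}^n\setminus\{0\}).$$ A distribution $h\in\mathcal{D}'(\mathbb{R}^n\setminus\{0\})$ is called homogeneous (of degree zero) if $U_ah=h$ for all $a>0$. Theorem. A distribution $f\in\mathcal{D}'(\mathbb{R}^n\setminus\{0\})$ belongs to $S_k(\lambda)$ if and only if there are homogeneous distributions $h_0,\dots,h_k\in\mathcal{D}'(\mathbb{R}^n\setminus\{0\})$ (homogeneous of degree zero, in the above sense) such that $$f=r^\lambda\sum_{j=0}^{k}h_j\log^j r\quad\text{on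 }\mathbb{R}^n\setminus\{0\},$$ where the products of distributions with the smooth functions $r^\lambda$ and $\log^j r$ on $\mathbb{R}^n\setminus\{0\}$ are the usual ones, $\langle\psi f,\varphi\rangle=\langle f,\psi\varphi\rangle$. -/

import Mathlib

open scoped Distributions ContDiff

/-- Complex-valued distributions on an open set `Ω`: the continuous `ℂ`-linear functionals on the
space of complex-valued test functions on `Ω`, with its canonical LF topology. -/
abbrev ComplexDistribution {E : Type*} [NormedAddCommGroup E] [NormedSpace ℝ E]
    (Ω : TopologicalSpace.Opens E) : Type _ :=
  𝓓(Ω, ℂ) →L[ℂ] ℂ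

section Multiplication

variable {E : Type*} [NormedAddCommGroup E] [NormedSpace ℝ E] {Ω : TopologicalSpace.Opens E}

theorem contDiff_mul_of_contDiffOn {ψ φ : E → ℂ} (hψ : ContDiffOn ℝ ∞ ψ Ω)
    (hφ : ContDiff ℝ ∞ φ) (hs : tsupport φ ⊆ Ω) : ContDiff ℝ ∞ (fun x => ψ x * φ x) := by
  rw [contDiff_iff_contDiffAt]
  intro x
  by_cases hx : x ∈ Ω
  · exact (hψ.contDiffAt (Ω.isOpen.mem_nhds hx)).mul hφ.contDiffAt
  · have h0 : φ =ᶠ[nhds x] 0 := notMem_tsupport_iff_eventuallyEq.1 fun h => hx (hs h)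
    refine (contDiffAt_const (c := (0 : ℂ))).congr_of_eventuallyEq ?_
    filter_upwards [h0] with y hy
    simp [hy]

/-- The test function `x ↦ ψ x * φ x`, where `ψ` is smooth on `Ω`. -/
noncomputable def TestFunction.mulSmooth {ψ : E → ℂ} (hψ : ContDiffOn ℝ ∞ ψ Ω) (φ : 𝓓(Ω, ℂ)) : 𝓓(Ω, ℂ) where
  toFun := fun x => ψ x * φ x
  contDiff' := contDiff_mul_of_contDiffOn hψ φ.contDiff φ.tsupport_subset
  hasCompactSupport' := φ.hasCompactSupport.mul_left
  tsupport_subset' := (tsupport_mul_subset_right (f := ψ) (g := φ)).trans φ.tsupport_subset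

theorem exists_norm_iteratedFDeriv_mul_le {ψ : E → ℂ} (hψ : ContDiffOn ℝ ∞ ψ Ω)
    {K : TopologicalSpace.Compacts E} (hK : (K : Set E) ⊆ Ω) (i : ℕ) :
    ∃ (s : Finset ℕ) (C : ℝ), 0 ≤ C ∧ ∀ φ : 𝓓_{K}(E, ℂ), ∀ x ∈ K,
      ‖iteratedFDeriv ℝ i (fun y => ψ y * φ y) x‖ ≤
        C * (s.sup fun j => ContDiffMapSupportedIn.seminorm ℂ E ℂ ⊤ K j) φ := by
  have hb : ∀ j : ℕ, ∃ C : ℝ, ∀ x ∈ K, ‖iteratedFDerivWithin ℝ j ψ Ω x‖ ≤ C := fun j =>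
    K.isCompact.exists_bound_of_continuousOn
      ((hψ.continuousOn_iteratedFDerivWithin (mod_cast le_top) Ω.isOpen.uniqueDiffOn).mono hK)
  choose C hC using hb
  refine ⟨Finset.Iic i, ∑ j ∈ Finset.range (i + 1), (i.choose j : ℝ) * |C j|,
    Finset.sum_nonneg fun j _ => by positivity, fun φ x hx => ?_⟩
  rw [← iteratedFDerivWithin_of_isOpen i Ω.isOpen (hK hx)]
  refine (norm_iteratedFDerivWithin_mul_le hψ φ.contDiff.contDiffOn Ω.isOpen.uniqueDiffOn
    (hK hx) (mod_cast le_top)).trans ?_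
  rw [Finset.sum_mul]
  refine Finset.sum_le_sum fun j _ => ?_
  gcongr
  · exact (hC j x hx).trans (le_abs_self _)
  · rw [iteratedFDerivWithin_of_isOpen _ Ω.isOpen (hK hx)]
    exact (ContDiffMapSupportedIn.norm_iteratedFDeriv_apply_le_seminorm_top ℂ).trans
      (Seminorm.le_finset_sup_apply (Finset.mem_Iic.2 (Nat.sub_le i j)))

/-- Multiplication by a function smooth on `Ω`, as a continuous linear map on test functions. -/
noncomputable def TestFunction.mulSmoothCLM {ψ : E → ℂ} (hψ : ContDiffOn ℝ ∞ ψ Ω) :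
    𝓓(Ω, ℂ) →L[ℂ] 𝓓(Ω, ℂ) :=
  TestFunction.limitCLM ℂ (TestFunction.mulSmooth hψ)
    (fun K hK => (TestFunction.ofSupportedInCLM ℂ hK).comp
      (ContDiffMapSupportedIn.mkCLM ℂ (K₂ := K) (n₂ := ⊤) (fun φ x => ψ x * φ x)
        (fun f g x => by simp [mul_add])
        (fun c f x => by simp [mul_left_comm])
        (fun φ => contDiff_mul_of_contDiffOn hψ φ.contDiff (φ.tsupport_subset.trans hK))
        (fun φ x hx => by simp [φ.zero_on_compl hx])
        (fun i _ => exists_norm_iteratedFDeriv_mul_le hψ hK i)))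
    (fun _ _ _ => rfl)

/-- The product `ψ f` of a distribution `f` on `Ω` and a function `ψ` smooth on `Ω`:
`⟨ψ f, φ⟩ = ⟨f, ψ φ⟩`. -/
noncomputable def ComplexDistribution.mulSmooth {ψ : E → ℂ} (hψ : ContDiffOn ℝ ∞ ψ Ω)
    (f : ComplexDistribution Ω) : ComplexDistribution Ω :=
  f.comp (TestFunction.mulSmoothCLM hψ)

end Multiplication

/-- The open set `ℝⁿ ∖ {0}`. -/
def puncturedSpace (n : ℕ) : TopologicalSpace.Opens (EuclideanSpace ℝ (Fin n)) :=
  ⟨{0}ᶜ, isOpen_compl_singleton⟩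

section Dilation

variable {n : ℕ}

/-- The test function `x ↦ φ (x / a)` for `a > 0`. -/
noncomputable def TestFunction.dilate (a : Set.Ioi (0 : ℝ)) (φ : 𝓓(puncturedSpace n, ℂ)) :
    𝓓(puncturedSpace n, ℂ) where
  toFun := fun x => φ ((a : ℝ)⁻¹ • x)
  contDiff' := φ.contDiff.comp (contDiff_const_smul _)
  hasCompactSupport' := φ.hasCompactSupport.comp_smul (inv_ne_zero (ne_of_gt a.2))
  tsupport_subset' := by
    intro x hx h0
    have h1 : (a : ℝ)⁻¹ • x ∈ tsupport φ :=
      tsupport_comp_subset_preimage φ (continuous_const_smul _) hx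
    have h2 : x = 0 := h0
    rw [h2, smul_zero] at h1
    exact φ.tsupport_subset h1 rfl

/-- The compact set `a K`. -/
def dilateCompacts (a : Set.Ioi (0 : ℝ))
    (K : TopologicalSpace.Compacts (EuclideanSpace ℝ (Fin n))) :
    TopologicalSpace.Compacts (EuclideanSpace ℝ (Fin n)) :=
  K.map (fun x => (a : ℝ) • x) (continuous_const_smul _)

theorem dilateCompacts_subset (a : Set.Ioi (0 : ℝ))
    {K : TopologicalSpace.Compacts (EuclideanSpace ℝ (Fin n))}
    (hK : (K : Set (EuclideanSpace ℝ (Fin n))) ⊆ puncturedSpace n) :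
    (dilateCompacts a K : Set (EuclideanSpace ℝ (Fin n))) ⊆ puncturedSpace n := by
  rintro _ ⟨x, hx, rfl⟩ h0
  exact hK hx ((smul_eq_zero.1 h0).resolve_left (ne_of_gt a.2))

/-- The map `φ ↦ φ (· / a)` as a continuous linear map on test functions. -/
noncomputable def TestFunction.dilateCLM (a : Set.Ioi (0 : ℝ)) :
    𝓓(puncturedSpace n, ℂ) →L[ℂ] 𝓓(puncturedSpace n, ℂ) :=
  TestFunction.limitCLM ℂ (TestFunction.dilate a)
    (fun K hK => (TestFunction.ofSupportedInCLM ℂ (dilateCompacts_subset a hK)).comp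
      (ContDiffMapSupportedIn.mkCLM ℂ (K₂ := dilateCompacts a K) (n₂ := ⊤)
        (fun φ x => φ ((a : ℝ)⁻¹ • x))
        (fun f g x => by simp)
        (fun c f x => by simp)
        (fun φ => φ.contDiff.comp (contDiff_const_smul _))
        (fun φ x hx => φ.zero_on_compl fun h =>
          hx ⟨(a : ℝ)⁻¹ • x, h, smul_inv_smul₀ (ne_of_gt a.2) x⟩)
        (fun i _ => ⟨{i}, ‖((a : ℝ)⁻¹) ^ i‖, norm_nonneg _, fun φ x _ => by
          rw [iteratedFDeriv_comp_const_smul _ (φ.contDiff.of_le (mod_cast le_top)), norm_smul,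
            Finset.sup_singleton]
          gcongr
          exact ContDiffMapSupportedIn.norm_iteratedFDeriv_apply_le_seminorm_top ℂ⟩)))
    (fun _ _ _ => rfl)

/-- The dilation operator `U_a f (x) = f (a x)`, `a > 0`, on distributions on `ℝⁿ ∖ {0}`:
`⟨U_a f, φ⟩ = a⁻ⁿ ⟨f, φ (· / a)⟩`. -/
noncomputable def dilationOp (a : Set.Ioi (0 : ℝ)) :
    Module.End ℂ (ComplexDistribution (puncturedSpace n)) where
  toFun f := (((a : ℝ) : ℂ) ^ n)⁻¹ • f.comp (TestFunction.dilateCLM a)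
  map_add' f g := by ext; simp
  map_smul' c f := by ext; simp [mul_left_comm]

/-- The spectral subspace `S_k(λ) = ⋂_{a > 0} ker (U_a - a ^ λ I) ^ (k + 1)`. -/
noncomputable def spectralSubspace (n k : ℕ) (lam : ℂ) :
    Submodule ℂ (ComplexDistribution (puncturedSpace n)) :=
  ⨅ a : Set.Ioi (0 : ℝ),
    LinearMap.ker ((dilationOp a -
      (((a : ℝ) : ℂ) ^ lam) • (1 : Module.End ℂ (ComplexDistribution (puncturedSpace n)))) ^ (k + 1))

/-- A distribution `h` on `ℝⁿ ∖ {0}` is homogeneous if it is dilation invariant, that is,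
`U_a h = h` for all `a > 0` (homogeneous of degree zero). -/
def IsHomogeneousDistribution (h : ComplexDistribution (puncturedSpace n)) : Prop :=
  ∀ a : Set.Ioi (0 : ℝ), dilationOp a h = h

theorem contDiffOn_norm_punctured :
    ContDiffOn ℝ ∞ (fun x : EuclideanSpace ℝ (Fin n) => ‖x‖) (puncturedSpace n) :=
  fun _ hx => (contDiffAt_norm ℝ hx).contDiffWithinAt

theorem contDiffOn_log_norm_pow (j : ℕ) :
    ContDiffOn ℝ ∞ (fun x : EuclideanSpace ℝ (Fin n) => ((Real.log ‖x‖ : ℝ) : ℂ) ^ j)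
      (puncturedSpace n) :=
  (Complex.ofRealCLM.contDiff.comp_contDiffOn
    (contDiffOn_norm_punctured.log fun _ hx => norm_ne_zero_iff.2 hx)).pow j

theorem contDiffOn_norm_cpow (lam : ℂ) :
    ContDiffOn ℝ ∞ (fun x : EuclideanSpace ℝ (Fin n) => ((‖x‖ : ℝ) : ℂ) ^ lam)
      (puncturedSpace n) := by
  have h : ContDiffOn ℝ ∞ (fun x : EuclideanSpace ℝ (Fin n) =>
      Complex.exp (((Real.log ‖x‖ : ℝ) : ℂ) * lam)) (puncturedSpace n) := by
    have h1 := contDiffOn_log_norm_pow (n := n) 1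
    simp only [pow_one] at h1
    exact (h1.mul contDiffOn_const).cexp
  refine h.congr fun x hx => ?_
  have hx0 : ((‖x‖ : ℝ) : ℂ) ≠ 0 := Complex.ofReal_ne_zero.2 (norm_ne_zero_iff.2 hx)
  rw [Complex.cpow_def_of_ne_zero hx0, Complex.ofReal_log (norm_nonneg x)]

end Dilation

/-!
Multiplication by `r ^ λ` intertwines `a ^ λ U_a` with `U_a`, so it is enough to treat `λ = 0`
(`mulSmooth_norm_cpow_mem_spectralSubspace`).

If `h` is homogeneous, then `U_a (logʲ r h) = (log r + log a)ʲ h`, so `U_a - 1` lowers the degree in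
`log r` and its `(k + 1)`-st power annihilates every polynomial of degree at most `k` in `log r` with
homogeneous coefficients (`sub_one_pow_mulSmooth_log_pow`).

Conversely, suppose that `(U_a - 1) ^ (k + 1) g = 0` for all `a > 0`. For a test function `φ`, the
function `t ↦ ⟨U_{e ^ t} g, φ⟩` is continuous, and its differences of order `k + 1` vanish for every
step; by Fréchet's theorem (`exists_polynomial_of_fwdDiff_iter_eq_zero`) it is a polynomial of degree
at most `k`. Hence `U_{e ^ t} g = ∑ tʲ c_j` with distributions `c_j` (`exists_dilationOp_eq_sum`).
The group law shows that the top coefficient `c_k` is homogeneous, and `g - logᵏ r c_k` has an orbit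
of degree at most `k - 1`, so induction on the degree produces the expansion of `g`
(`exists_homogeneous_log_expansion`).
-/

/-! ### Continuous functions with vanishing iterated differences -/

open Polynomial in
/-- A function whose differences of order `k + 1` and step `h` vanish is a polynomial of degree at
most `k` along every progression of step `h`: the Gregory-Newton formula is a finite sum. -/
theorem exists_polynomial_eval_add_nsmul {F : ℝ → ℂ} {k : ℕ} {h : ℝ}
    (hF : (fwdDiff h)^[k + 1] F = 0) (y : ℝ) :
    ∃ p : ℂ[X], p.degree < ↑(k + 1) ∧ ∀ m : ℕ, F (y + m • h) = p.eval (m : ℂ) := by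
  refine ⟨∑ j ∈ Finset.range (k + 1),
    C (((fwdDiff h)^[j] F y) / (j.factorial : ℂ)) * descPochhammer ℂ j, ?_, fun m => ?_⟩
  · refine (degree_sum_le _ _).trans_lt ((Finset.sup_lt_iff (WithBot.bot_lt_coe _)).2 fun j hj => ?_)
    refine (degree_le_natDegree.trans (Nat.cast_le.2 (natDegree_C_mul_le _ _))).trans_lt ?_
    rw [descPochhammer_natDegree]
    exact_mod_cast Finset.mem_range.1 hj
  · rw [shift_eq_sum_fwdDiff_iter h F m y, eval_finsetSum]
    have key : ∀ j, m.choose j • (fwdDiff h)^[j] F y =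
        eval (m : ℂ) (C (((fwdDiff h)^[j] F y) / (j.factorial : ℂ)) * descPochhammer ℂ j) := by
      intro j
      rw [eval_mul, eval_C, descPochhammer_eval_eq_descFactorial,
        Nat.descFactorial_eq_factorial_mul_choose, nsmul_eq_mul]
      have : (j.factorial : ℂ) ≠ 0 := by exact_mod_cast j.factorial_ne_zero
      push_cast
      field_simp
    simp_rw [← key]
    -- Both ranges may be truncated: `m.choose j = 0` for `j > m`, the differences vanish for `j > k`.
    have hz : ∀ j, k < j → (fwdDiff h)^[j] F y = 0 := by
      intro j hj
      obtain ⟨d, rfl⟩ := Nat.exists_eq_add_of_le' (Nat.succ_le_of_lt hj)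
      rw [Nat.succ_eq_add_one, Function.iterate_add_apply, hF]
      clear hj key
      induction d generalizing y with
      | zero => rfl
      | succ d ih => rw [Function.iterate_succ_apply', fwdDiff, ih, ih, sub_zero]
    rcases le_total m k with hmk | hmk
    · refine Finset.sum_subset (Finset.range_mono (by omega)) fun j _ hj => ?_
      rw [Nat.choose_eq_zero_of_lt (by simpa using hj), zero_smul]
    · refine (Finset.sum_subset (Finset.range_mono (by omega)) fun j _ hj => ?_).symm
      rw [hz j (by simpa using hj), smul_zero]

open Polynomial in
/-- Fréchet's theorem: a continuous function on the line whose differences of order `k + 1` vanish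
for every step is a polynomial of degree at most `k`. The polynomials found along the progressions
of step `1` and `1 / d` agree at the integers `0, …, k`, hence are equal; this covers the rational
points, and continuity does the rest. -/
theorem exists_polynomial_of_fwdDiff_iter_eq_zero {F : ℝ → ℂ} (hc : Continuous F) {k : ℕ}
    (hF : ∀ h, (fwdDiff h)^[k + 1] F = 0) :
    ∃ p : ℂ[X], p.degree < ↑(k + 1) ∧ ∀ t : ℝ, F t = p.eval (t : ℂ) := by
  obtain ⟨p, hp, hpF⟩ := exists_polynomial_eval_add_nsmul (hF 1) 0
  refine ⟨p, hp, ?_⟩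
  have hpc : Continuous fun t : ℝ => p.eval (t : ℂ) := p.continuous.comp Complex.continuous_ofReal
  refine congrFun (Rat.isDenseEmbedding_coe_real.dense.equalizer hc hpc (funext fun x => ?_))
  have hd : (x.den : ℝ) ≠ 0 := by exact_mod_cast x.den_ne_zero
  have hdC : (x.den : ℂ) ≠ 0 := by exact_mod_cast x.den_ne_zero
  -- On the progression of step `1 / x.den` starting at the integer `-M`, `F` is a polynomial.
  set M : ℕ := x.num.natAbs
  obtain ⟨q, hq, hqF⟩ := exists_polynomial_eval_add_nsmul (hF (x.den : ℝ)⁻¹) (-(M : ℝ))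
  have hqF' : ∀ j : ℕ, F (-(M : ℝ) + (j : ℝ) / x.den) = q.eval (j : ℂ) := fun j => by
    rw [← hqF j, nsmul_eq_mul, div_eq_mul_inv]
  have hcomp : q.comp ((C (x.den : ℂ)) * (X + C (M : ℂ))) = p := by
    refine eq_of_degrees_lt_of_eval_index_eq (Finset.range (k + 1))
      (v := fun j : ℕ => (j : ℂ)) (Nat.cast_injective.injOn) ?_ (by simpa using hp) fun j _ => ?_
    · rw [Finset.card_range]
      refine degree_le_natDegree.trans_lt ?_
      have h1 : (q.comp ((C (x.den : ℂ)) * (X + C (M : ℂ)))).natDegree ≤ q.natDegree := by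
        refine natDegree_comp_le.trans ?_
        rw [natDegree_C_mul hdC, natDegree_X_add_C, mul_one]
      have h2 : q.natDegree < k + 1 := by
        rcases eq_or_ne q 0 with rfl | h0
        · simp
        · exact (natDegree_lt_iff_degree_lt h0).2 hq
      exact_mod_cast h1.trans_lt h2
    · have h1 := hqF' (x.den * (j + M))
      have h2 := hpF j
      have h3 : -(M : ℝ) + ((x.den * (j + M) : ℕ) : ℝ) / x.den = 0 + j • (1 : ℝ) := by
        push_cast
        rw [mul_div_cancel_left₀ _ hd, nsmul_eq_mul]
        ring
      rw [h3, h2] at h1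
      rw [h1]
      simp [eval_comp]
  obtain ⟨N, hN⟩ : ∃ N : ℕ, (N : ℤ) = x.num + x.den * M := by
    refine ⟨(x.num + x.den * M).toNat, Int.toNat_of_nonneg ?_⟩
    have h1 : -(M : ℤ) ≤ x.num := by omega
    have h2 : (M : ℤ) ≤ x.den * M := le_mul_of_one_le_left (by omega) (by exact_mod_cast x.pos)
    linarith
  have hNR : (N : ℝ) = x.num + x.den * M := by exact_mod_cast hN
  have hxR : (x : ℝ) = -(M : ℝ) + (N : ℝ) / x.den := by
    rw [hNR, Rat.cast_def]
    field_simp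
    ring
  have hxC : (N : ℂ) = x.den * (((x : ℝ) : ℂ) + M) := by
    rw [hxR]
    push_cast
    field_simp
    ring
  change F (x : ℝ) = p.eval ((x : ℝ) : ℂ)
  conv_lhs => rw [hxR, hqF', hxC]
  rw [← hcomp]
  simp [eval_comp]

/-! ### Continuity of dilation on test functions -/

section Continuity

open scoped BoundedContinuousFunction Topology

/-- A family of bounded continuous functions vanishing off a common compact set and jointly
continuous in parameter and variable depends continuously on the parameter for the sup norm. -/
theorem BoundedContinuousFunction.continuous_of_uncurry_of_eq_zero_off_compact {X E G : Type*}
    [UniformSpace X] [WeaklyLocallyCompactSpace X] [NormedAddCommGroup E] [NormedAddCommGroup G]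
    {Φ : X → E →ᵇ G} (hΦ : Continuous fun q : X × E => Φ q.1 q.2) {K : Set E} (hK : IsCompact K)
    (h0 : ∀ s, ∀ x ∉ K, Φ s x = 0) : Continuous Φ := by
  rw [continuous_iff_continuousAt]
  intro s
  have : CompactSpace K := isCompact_iff_compactSpace.1 hK
  have hu : TendstoUniformly (fun (s : X) (x : K) => Φ s x) (fun x : K => Φ s x) (𝓝 s) :=
    Continuous.tendstoUniformly (fun (s : X) (x : K) => Φ s x)
      (hΦ.comp (continuous_fst.prodMk (continuous_subtype_val.comp continuous_snd))) s
  rw [ContinuousAt, BoundedContinuousFunction.tendsto_iff_tendstoUniformly,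
    Metric.tendstoUniformly_iff]
  rw [Metric.tendstoUniformly_iff] at hu
  intro ε hε
  filter_upwards [hu ε hε] with t ht x
  by_cases hx : x ∈ K
  · exact ht ⟨x, hx⟩
  · rwa [h0 s x hx, h0 t x hx, dist_self]

variable {n : ℕ}

/-- The dilation factor `e ^ t`, which turns the multiplicative group of dilations into an additive
one-parameter group. -/
noncomputable def expPos (t : ℝ) : Set.Ioi (0 : ℝ) := ⟨Real.exp t, Real.exp_pos t⟩

/-- The curve `t ↦ φ (e⁻ᵗ ·)` is continuous for the LF topology: for `t` in a bounded interval it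
stays in the space of test functions supported in one compact set, where each derivative converges
uniformly. -/
theorem continuous_dilate_expPos (φ : 𝓓(puncturedSpace n, ℂ)) :
    Continuous fun t : ℝ => TestFunction.dilate (expPos t) φ := by
  rw [continuous_iff_continuousAt]
  intro t₀
  set I : Set ℝ := Set.Icc (t₀ - 1) (t₀ + 1) with hI
  refine ContinuousOn.continuousAt (s := I) ?_ (Icc_mem_nhds (by linarith) (by linarith))
  rw [continuousOn_iff_continuous_domRestrict]
  -- `K` contains the supports of all dilates with parameter in `I`.
  let K : TopologicalSpace.Compacts (EuclideanSpace ℝ (Fin n)) :=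
    ⟨(fun q : ℝ × EuclideanSpace ℝ (Fin n) => Real.exp q.1 • q.2) '' (I ×ˢ tsupport φ),
      (isCompact_Icc.prod φ.hasCompactSupport).image (by fun_prop)⟩
  have hK : (K : Set (EuclideanSpace ℝ (Fin n))) ⊆ puncturedSpace n := by
    rintro _ ⟨⟨s, x⟩, ⟨_, hx⟩, rfl⟩ h0
    exact φ.tsupport_subset hx ((smul_eq_zero.1 h0).resolve_left (Real.exp_ne_zero s))
  let Ψ : I → 𝓓_{K}(EuclideanSpace ℝ (Fin n), ℂ) := fun s =>
    ContDiffMapSupportedIn.of_support_subset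
      (f := fun x => φ (((expPos s : Set.Ioi (0 : ℝ)) : ℝ)⁻¹ • x))
      (φ.contDiff.comp (contDiff_const_smul _))
      (by
        intro x hx
        refine ⟨(s, (Real.exp s)⁻¹ • x), ⟨s.2, subset_tsupport _ hx⟩, ?_⟩
        exact smul_inv_smul₀ (Real.exp_ne_zero _) x)
  refine (TestFunction.continuous_ofSupportedIn hK).comp (f := Ψ) ?_
  rw [ContDiffMapSupportedIn.continuous_iff_comp]
  intro i
  refine BoundedContinuousFunction.continuous_of_uncurry_of_eq_zero_off_compact (K := K) ?_
    K.isCompact ?_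
  · have h1 : ∀ q : I × EuclideanSpace ℝ (Fin n),
        ContDiffMapSupportedIn.structureMapCLM ℝ ⊤ i (Ψ q.1) q.2 =
          ((Real.exp q.1)⁻¹) ^ i • iteratedFDeriv ℝ i φ ((Real.exp q.1)⁻¹ • q.2) := fun q => by
      rw [ContDiffMapSupportedIn.structureMapCLM_top_apply]
      exact congrFun (iteratedFDeriv_comp_const_smul _ (φ.contDiff.of_le (mod_cast le_top))) q.2
    refine Continuous.congr ?_ fun q => (h1 q).symm
    have h2 : Continuous fun q : I × EuclideanSpace ℝ (Fin n) => (Real.exp q.1)⁻¹ :=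
      Continuous.inv₀ (by fun_prop) fun q => Real.exp_ne_zero _
    exact (h2.pow i).smul ((φ.contDiff.continuous_iteratedFDeriv (mod_cast le_top)).comp
      (h2.smul continuous_snd))
  · intro s x hx
    rw [Function.comp_apply, ContDiffMapSupportedIn.structureMapCLM_top_apply]
    exact ContDiffMapSupportedIn.iteratedFDeriv_zero_on_compl _ hx

end Continuity

/-! ### Multiplication of distributions by smooth functions -/

section MulSmooth

variable {E : Type*} [NormedAddCommGroup E] [NormedSpace ℝ E] {Ω : TopologicalSpace.Opens E}

theorem TestFunction.eq_zero_of_notMem (φ : 𝓓(Ω, ℂ)) {x : E} (hx : x ∉ Ω) : φ x = 0 :=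
  image_eq_zero_of_notMem_tsupport fun h => hx (φ.tsupport_subset h)

namespace ComplexDistribution

/-- Multiplication of distributions on `Ω` by a function smooth on `Ω`, as a linear map. -/
noncomputable def mulSmoothₗ {ψ : E → ℂ} (hψ : ContDiffOn ℝ ∞ ψ Ω) :
    Module.End ℂ (ComplexDistribution Ω) where
  toFun := mulSmooth hψ
  map_add' _ _ := rfl
  map_smul' _ _ := rfl

theorem mulSmooth_apply {ψ : E → ℂ} (hψ : ContDiffOn ℝ ∞ ψ Ω) (f : ComplexDistribution Ω)
    (φ : 𝓓(Ω, ℂ)) : mulSmooth hψ f φ = f (TestFunction.mulSmooth hψ φ) :=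
  rfl

theorem mulSmooth_eq_sum {ι : Type*} (s : Finset ι) {χ : E → ℂ} (hχ : ContDiffOn ℝ ∞ χ Ω)
    {ψ : ι → E → ℂ} (hψ : ∀ i, ContDiffOn ℝ ∞ (ψ i) Ω) (c : ι → ℂ)
    (h : ∀ x ∈ Ω, χ x = ∑ i ∈ s, c i * ψ i x) (f : ComplexDistribution Ω) :
    mulSmooth hχ f = ∑ i ∈ s, c i • mulSmooth (hψ i) f := by
  ext φ
  rw [mulSmooth_apply]
  have : TestFunction.mulSmooth hχ φ = ∑ i ∈ s, c i • TestFunction.mulSmooth (hψ i) φ := by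
    ext x
    have hs : (∑ i ∈ s, c i • TestFunction.mulSmooth (hψ i) φ) x =
        ∑ i ∈ s, c i * (ψ i x * φ x) := by
      simp only [FunLike.coe_sum, Finset.sum_apply]
      rfl
    rw [hs]
    change χ x * φ x = _
    by_cases hx : x ∈ Ω
    · rw [h x hx, Finset.sum_mul]
      exact Finset.sum_congr rfl fun i _ => mul_assoc _ _ _
    · simp [φ.eq_zero_of_notMem hx]
  rw [this, map_sum]
  simp [mulSmooth_apply]

theorem mulSmooth_eq_smul {χ ψ : E → ℂ} (hχ : ContDiffOn ℝ ∞ χ Ω) (hψ : ContDiffOn ℝ ∞ ψ Ω)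
    (c : ℂ) (h : ∀ x ∈ Ω, χ x = c * ψ x) (f : ComplexDistribution Ω) :
    mulSmooth hχ f = c • mulSmooth hψ f := by
  simpa using mulSmooth_eq_sum {()} hχ (fun _ => hψ) (fun _ => c) (by simpa using h) f

theorem mulSmooth_mulSmooth_eq_self {χ ψ : E → ℂ} (hχ : ContDiffOn ℝ ∞ χ Ω)
    (hψ : ContDiffOn ℝ ∞ ψ Ω) (h : ∀ x ∈ Ω, χ x * ψ x = 1) (f : ComplexDistribution Ω) :
    mulSmooth hχ (mulSmooth hψ f) = f := by
  ext φ
  rw [mulSmooth_apply, mulSmooth_apply]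
  congr 1
  ext x
  change ψ x * (χ x * φ x) = φ x
  by_cases hx : x ∈ Ω
  · rw [← mul_assoc, mul_comm (ψ x), h x hx, one_mul]
  · simp [φ.eq_zero_of_notMem hx]

theorem mulSmooth_eq_self {ψ : E → ℂ} (hψ : ContDiffOn ℝ ∞ ψ Ω) (h : ∀ x ∈ Ω, ψ x = 1)
    (f : ComplexDistribution Ω) : mulSmooth hψ f = f := by
  ext φ
  rw [mulSmooth_apply]
  congr 1
  ext x
  change ψ x * φ x = φ x
  by_cases hx : x ∈ Ω
  · rw [h x hx, one_mul]
  · simp [φ.eq_zero_of_notMem hx]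

end ComplexDistribution

end MulSmooth

/-! ### The dilation group and multiplication by powers of the norm and of its logarithm -/

section Dilation

open ComplexDistribution

variable {n : ℕ}

theorem dilationOp_apply_apply (a : Set.Ioi (0 : ℝ)) (f : ComplexDistribution (puncturedSpace n))
    (φ : 𝓓(puncturedSpace n, ℂ)) :
    dilationOp a f φ = (((a : ℝ) : ℂ) ^ n)⁻¹ * f (TestFunction.dilate a φ) :=
  rfl

theorem dilationOp_expPos_add (s t : ℝ) (f : ComplexDistribution (puncturedSpace n)) :
    dilationOp (expPos (s + t)) f = dilationOp (expPos s) (dilationOp (expPos t) f) := by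
  ext φ
  simp only [dilationOp_apply_apply]
  rw [← mul_assoc]
  congr 1
  · simp [expPos, Real.exp_add, mul_pow, mul_comm]
  · congr 1
    ext x
    change φ ((Real.exp (s + t))⁻¹ • x) = φ ((Real.exp s)⁻¹ • (Real.exp t)⁻¹ • x)
    rw [smul_smul, Real.exp_add, mul_inv]

theorem dilationOp_expPos_zero (f : ComplexDistribution (puncturedSpace n)) :
    dilationOp (expPos 0) f = f := by
  ext φ
  rw [dilationOp_apply_apply]
  have : TestFunction.dilate (expPos 0) φ = φ := by
    ext x
    change φ ((Real.exp 0)⁻¹ • x) = φ x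
    simp
  rw [this]
  simp [expPos]

theorem expPos_surjective : Function.Surjective expPos := fun a =>
  ⟨Real.log a, Subtype.ext (Real.exp_log a.2)⟩

/-- `U_a (ψ f) = ψ (a ·) U_a f`. -/
theorem dilationOp_mulSmooth (a : Set.Ioi (0 : ℝ)) {χ ψ : EuclideanSpace ℝ (Fin n) → ℂ}
    (hχ : ContDiffOn ℝ ∞ χ (puncturedSpace n)) (hψ : ContDiffOn ℝ ∞ ψ (puncturedSpace n))
    (h : ∀ x ∈ puncturedSpace n, ψ ((a : ℝ) • x) = χ x)
    (f : ComplexDistribution (puncturedSpace n)) :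
    dilationOp a (mulSmooth hψ f) = mulSmooth hχ (dilationOp a f) := by
  ext φ
  rw [mulSmooth_apply, dilationOp_apply_apply, dilationOp_apply_apply, mulSmooth_apply]
  congr 2
  ext x
  change ψ x * φ ((a : ℝ)⁻¹ • x) = χ ((a : ℝ)⁻¹ • x) * φ ((a : ℝ)⁻¹ • x)
  have ha : (a : ℝ) ≠ 0 := ne_of_gt a.2
  by_cases hx : (a : ℝ)⁻¹ • x ∈ puncturedSpace n
  · rw [← h _ hx, smul_inv_smul₀ ha]
  · simp [φ.eq_zero_of_notMem hx]

/-- The binomial expansion of `U_a (logʲ r f) = (t + log r)ʲ U_a f`, where `a = e ^ t`. -/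
theorem dilationOp_expPos_mulSmooth_log_pow (t : ℝ) (j : ℕ)
    (f : ComplexDistribution (puncturedSpace n)) :
    dilationOp (expPos t) (mulSmooth (contDiffOn_log_norm_pow j) f) =
      ∑ m ∈ Finset.range (j + 1), ((t : ℂ) ^ m * j.choose m) •
        mulSmooth (contDiffOn_log_norm_pow (j - m)) (dilationOp (expPos t) f) := by
  have hχ : ContDiffOn ℝ ∞ (fun x : EuclideanSpace ℝ (Fin n) =>
      ((t : ℂ) + ((Real.log ‖x‖ : ℝ) : ℂ)) ^ j) (puncturedSpace n) := by
    have h1 := contDiffOn_log_norm_pow (n := n) 1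
    simp only [pow_one] at h1
    exact (contDiffOn_const.add h1).pow j
  rw [dilationOp_mulSmooth _ hχ]
  · refine mulSmooth_eq_sum _ hχ (fun m => contDiffOn_log_norm_pow (j - m)) _ (fun x _ => ?_) _
    rw [add_pow]
    exact Finset.sum_congr rfl fun m _ => by ring
  · intro x hx
    rw [expPos, norm_smul, Real.norm_eq_abs, abs_of_pos (Real.exp_pos t),
      Real.log_mul (Real.exp_ne_zero t) (norm_ne_zero_iff.2 hx), Real.log_exp, Complex.ofReal_add]

theorem dilationOp_mulSmooth_norm_cpow (a : Set.Ioi (0 : ℝ)) (lam : ℂ)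
    (f : ComplexDistribution (puncturedSpace n)) :
    dilationOp a (mulSmooth (contDiffOn_norm_cpow lam) f) =
      (((a : ℝ) : ℂ) ^ lam) • mulSmooth (contDiffOn_norm_cpow lam) (dilationOp a f) := by
  have hχ : ContDiffOn ℝ ∞ (fun x : EuclideanSpace ℝ (Fin n) =>
      (((a : ℝ) : ℂ) ^ lam) * ((‖x‖ : ℝ) : ℂ) ^ lam) (puncturedSpace n) :=
    contDiffOn_const.mul (contDiffOn_norm_cpow lam)
  rw [dilationOp_mulSmooth _ hχ]
  · exact mulSmooth_eq_smul hχ _ _ (fun _ _ => rfl) _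
  · intro x _
    rw [norm_smul, Real.norm_eq_abs, abs_of_pos a.2, Complex.ofReal_mul,
      Complex.mul_cpow_ofReal_nonneg a.2.le (norm_nonneg x)]

theorem mulSmooth_norm_cpow_cancel (lam : ℂ) (f : ComplexDistribution (puncturedSpace n)) :
    mulSmooth (contDiffOn_norm_cpow lam) (mulSmooth (contDiffOn_norm_cpow (-lam)) f) = f := by
  refine mulSmooth_mulSmooth_eq_self _ _ (fun x hx => ?_) f
  have hx0 : ((‖x‖ : ℝ) : ℂ) ≠ 0 := Complex.ofReal_ne_zero.2 (norm_ne_zero_iff.2 hx)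
  rw [← Complex.cpow_add _ _ hx0, add_neg_cancel, Complex.cpow_zero]

theorem mem_spectralSubspace {k : ℕ} {lam : ℂ} {f : ComplexDistribution (puncturedSpace n)} :
    f ∈ spectralSubspace n k lam ↔ ∀ a : Set.Ioi (0 : ℝ),
      ((dilationOp a - (((a : ℝ) : ℂ) ^ lam) •
        (1 : Module.End ℂ (ComplexDistribution (puncturedSpace n)))) ^ (k + 1) :
        Module.End ℂ (ComplexDistribution (puncturedSpace n))) f = 0 := by
  simp only [spectralSubspace, Submodule.mem_iInf, LinearMap.mem_ker]

theorem sub_smul_pow_mulSmooth_norm_cpow (a : Set.Ioi (0 : ℝ)) (lam : ℂ) (m : ℕ)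
    (f : ComplexDistribution (puncturedSpace n)) :
    ((dilationOp a - (((a : ℝ) : ℂ) ^ lam) •
        (1 : Module.End ℂ (ComplexDistribution (puncturedSpace n)))) ^ m :
        Module.End ℂ (ComplexDistribution (puncturedSpace n)))
        (mulSmooth (contDiffOn_norm_cpow lam) f) =
      ((((a : ℝ) : ℂ) ^ lam) ^ m) • mulSmooth (contDiffOn_norm_cpow lam)
        (((dilationOp a - 1) ^ m) f) := by
  induction m with
  | zero => simp
  | succ m ih =>
    rw [pow_succ', Module.End.mul_apply, ih, pow_succ' (dilationOp a - 1), Module.End.mul_apply,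
      map_smul, LinearMap.sub_apply, dilationOp_mulSmooth_norm_cpow, LinearMap.sub_apply,
      LinearMap.smul_apply, Module.End.one_apply, Module.End.one_apply]
    have hsub := map_sub (mulSmoothₗ (contDiffOn_norm_cpow (n := n) lam))
      (dilationOp a (((dilationOp a - 1) ^ m) f)) (((dilationOp a - 1) ^ m) f)
    change mulSmooth _ _ = mulSmooth _ _ - mulSmooth _ _ at hsub
    rw [hsub]
    module

theorem mulSmooth_norm_cpow_injective (lam : ℂ) :
    Function.Injective (mulSmooth (contDiffOn_norm_cpow (n := n) lam)) := by
  refine Function.LeftInverse.injective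
    (g := mulSmooth (contDiffOn_norm_cpow (n := n) (-lam))) fun f => ?_
  simpa using mulSmooth_norm_cpow_cancel (-lam) f

/-- Division by `r ^ λ` reduces the spectral condition at `λ` to the one at `0`. -/
theorem mulSmooth_norm_cpow_mem_spectralSubspace {k : ℕ} {lam : ℂ}
    {f : ComplexDistribution (puncturedSpace n)} :
    mulSmooth (contDiffOn_norm_cpow lam) f ∈ spectralSubspace n k lam ↔
      ∀ a : Set.Ioi (0 : ℝ), ((dilationOp a - 1) ^ (k + 1)) f = 0 := by
  rw [mem_spectralSubspace]
  refine forall_congr' fun a => ?_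
  have ha : (((a : ℝ) : ℂ) ^ lam) ^ (k + 1) ≠ 0 :=
    pow_ne_zero _ (by
      simp [Complex.cpow_eq_zero_iff, (Set.mem_Ioi.1 a.2).ne'])
  rw [sub_smul_pow_mulSmooth_norm_cpow]
  refine (smul_eq_zero_iff_right (M := ComplexDistribution (puncturedSpace n)) ha).trans ?_
  exact map_eq_zero_iff (mulSmoothₗ (contDiffOn_norm_cpow lam)) (mulSmooth_norm_cpow_injective lam)

/-! ### Sums of homogeneous distributions times powers of the logarithm -/

/-- `U_a - 1` maps `logʲ r h` to a combination of `logⁱ r h` with `i < j`, so its powers of exponent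
greater than `j` annihilate `logʲ r h`. -/
theorem sub_one_pow_mulSmooth_log_pow {h : ComplexDistribution (puncturedSpace n)}
    (hh : IsHomogeneousDistribution h) (a : Set.Ioi (0 : ℝ)) (j : ℕ) :
    ∀ m, j < m → ((dilationOp a - 1) ^ m) (mulSmooth (contDiffOn_log_norm_pow j) h) = 0 := by
  obtain ⟨t, rfl⟩ := expPos_surjective a
  induction j using Nat.strong_induction_on with
  | _ j ih =>
    intro m hm
    obtain ⟨m, rfl⟩ := Nat.exists_eq_add_of_lt hm
    rw [pow_succ, Module.End.mul_apply, LinearMap.sub_apply, dilationOp_expPos_mulSmooth_log_pow,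
      hh, Module.End.one_apply, Finset.sum_range_succ']
    simp only [pow_zero, Nat.choose_zero_right, Nat.cast_one, mul_one, one_smul, Nat.sub_zero,
      add_sub_cancel_right, map_sum, map_smul]
    refine Finset.sum_eq_zero fun i hi => ?_
    have hi := Finset.mem_range.1 hi
    rw [ih (j - (i + 1)) (by omega) (j + m) (by omega)]
    exact smul_zero (M := ℂ) (A := ComplexDistribution (puncturedSpace n)) _

/-! ### Polynomial orbits of the dilation group -/

theorem fwdDiff_iter_dilationOp (g : ComplexDistribution (puncturedSpace n))
    (φ : 𝓓(puncturedSpace n, ℂ)) (h : ℝ) (m : ℕ) (y : ℝ) :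
    (fwdDiff h)^[m] (fun t => dilationOp (expPos t) g φ) y =
      dilationOp (expPos y) (((dilationOp (expPos h) - 1) ^ m) g) φ := by
  induction m generalizing y with
  | zero => rfl
  | succ m ih =>
    rw [Function.iterate_succ_apply', fwdDiff, ih, ih, dilationOp_expPos_add, pow_succ',
      Module.End.mul_apply, LinearMap.sub_apply, Module.End.one_apply, map_sub]
    rfl

open Polynomial in
/-- If all the operators `(U_a - 1) ^ (k + 1)` annihilate `g`, then `t ↦ U_{e ^ t} g` is a polynomial
in `t` of degree at most `k` with coefficients in the space of distributions. Pairing with test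
functions, this is Fréchet's theorem; Lagrange interpolation at the nodes `0, …, k` writes the
coefficients as combinations of the distributions `U_{e ^ i} g`, so that they are continuous. -/
theorem exists_dilationOp_eq_sum {k : ℕ} {g : ComplexDistribution (puncturedSpace n)}
    (hg : ∀ a : Set.Ioi (0 : ℝ), ((dilationOp a - 1) ^ (k + 1)) g = 0) :
    ∃ c : ℕ → ComplexDistribution (puncturedSpace n), ∀ t : ℝ,
      dilationOp (expPos t) g = ∑ j ∈ Finset.range (k + 1), ((t : ℂ) ^ j) • c j := by
  let ℓ : ℕ → ℂ[X] := Lagrange.basis (Finset.range (k + 1)) fun i : ℕ => (i : ℂ)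
  have hinj : Set.InjOn (fun i : ℕ => (i : ℂ)) (Finset.range (k + 1)) := Nat.cast_injective.injOn
  refine ⟨fun j => ∑ i ∈ Finset.range (k + 1), (ℓ i).coeff j • dilationOp (expPos i) g,
    fun t => ?_⟩
  have hlag : dilationOp (expPos t) g =
      ∑ i ∈ Finset.range (k + 1), (ℓ i).eval (t : ℂ) • dilationOp (expPos i) g := by
    ext φ
    have hcont : Continuous fun s : ℝ => dilationOp (expPos s) g φ := by
      simp only [dilationOp_apply_apply, expPos]
      refine Continuous.mul ?_ (g.continuous.comp (continuous_dilate_expPos φ))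
      exact Continuous.inv₀ (by fun_prop) fun s =>
        pow_ne_zero _ (Complex.ofReal_ne_zero.2 (Real.exp_ne_zero s))
    obtain ⟨p, hp, hpF⟩ := exists_polynomial_of_fwdDiff_iter_eq_zero hcont (k := k) fun h => by
      ext y
      rw [fwdDiff_iter_dilationOp, hg, map_zero]
      rfl
    have hp' := Lagrange.eq_interpolate hinj (by simpa using hp)
    rw [hpF t, hp', Lagrange.interpolate_apply, eval_finsetSum]
    simp only [FunLike.coe_sum, Finset.sum_apply, smul_apply,
      smul_eq_mul, eval_mul, eval_C]
    refine Finset.sum_congr rfl fun i _ => ?_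
    have := hpF (i : ℝ)
    rw [Complex.ofReal_natCast] at this
    rw [← this, mul_comm]
  simp only [hlag, Finset.smul_sum]
  rw [Finset.sum_comm]
  refine Finset.sum_congr rfl fun i hi => ?_
  rw [eval_eq_sum_range' (n := k + 1)]
  · refine (Finset.sum_smul (M := ComplexDistribution (puncturedSpace n))).trans
      (Finset.sum_congr rfl fun j _ => ?_)
    rw [smul_smul, mul_comm]
  · rw [Lagrange.natDegree_basis hinj hi, Finset.card_range]
    omega

open Polynomial in
/-- The coefficient of `t ^ k` in an orbit `t ↦ U_{e ^ t} g` that is a polynomial of degree at most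
`k` is homogeneous: translating a polynomial does not change its top coefficient. -/
theorem isHomogeneousDistribution_leading_coeff {k : ℕ}
    {g : ComplexDistribution (puncturedSpace n)} {c : ℕ → ComplexDistribution (puncturedSpace n)}
    (hg : ∀ t : ℝ, dilationOp (expPos t) g = ∑ j ∈ Finset.range (k + 1), ((t : ℂ) ^ j) • c j) :
    IsHomogeneousDistribution (c k) := by
  intro a
  obtain ⟨t, rfl⟩ := expPos_surjective a
  ext φ
  let p : ℂ[X] := ∑ j ∈ Finset.range (k + 1), C (dilationOp (expPos t) (c j) φ) * X ^ j
  let q : ℂ[X] := ∑ j ∈ Finset.range (k + 1), C (c j φ) * (X + C (t : ℂ)) ^ j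
  -- Both polynomials represent `s ↦ ⟨U_{e ^ (t + s)} g, φ⟩`.
  have hpq : p = q := by
    refine Polynomial.eq_of_infinite_eval_eq p q
      ((Set.infinite_range_of_injective Complex.ofReal_injective).mono ?_)
    rintro _ ⟨s, rfl⟩
    have h1 := congrArg (fun f => f φ) (dilationOp_expPos_add t s g)
    simp only [hg, map_sum, map_smul, FunLike.coe_sum, Finset.sum_apply,
      smul_apply, smul_eq_mul] at h1
    simp only [Set.mem_ofPred_eq, p, q, eval_finsetSum, eval_mul, eval_C, eval_pow, eval_X, eval_add]
    simp only [Complex.ofReal_add] at h1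
    simpa only [mul_comm, add_comm] using h1.symm
  have hp : p.coeff k = dilationOp (expPos t) (c k) φ := by
    simp [p, finsetSum_coeff, coeff_X_pow]
  have hq : q.coeff k = c k φ := by
    simp only [q, finsetSum_coeff, coeff_C_mul, coeff_X_add_C_pow]
    rw [Finset.sum_range_succ, Finset.sum_eq_zero]
    · simp
    · intro j hj
      rw [Nat.choose_eq_zero_of_lt (Finset.mem_range.1 hj)]
      simp
  rw [← hp, hpq, hq]

/-- A distribution with polynomial orbit under dilation is a polynomial in `log r` with homogeneous
coefficients. -/
theorem exists_homogeneous_log_expansion (k : ℕ) :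
    ∀ (g : ComplexDistribution (puncturedSpace n)) (c : ℕ → ComplexDistribution (puncturedSpace n)),
      (∀ t : ℝ, dilationOp (expPos t) g = ∑ j ∈ Finset.range k, ((t : ℂ) ^ j) • c j) →
      ∃ h : ℕ → ComplexDistribution (puncturedSpace n), (∀ j, IsHomogeneousDistribution (h j)) ∧
        g = ∑ j ∈ Finset.range k, mulSmooth (contDiffOn_log_norm_pow j) (h j) := by
  induction k with
  | zero =>
    intro g c hg
    refine ⟨0, fun j a => map_zero _, ?_⟩
    rw [← dilationOp_expPos_zero g, hg]
    simp
  | succ k ih =>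
    intro g c hg
    have hk := isHomogeneousDistribution_leading_coeff hg
    -- Subtracting `(log r) ^ k` times the top coefficient lowers the degree of the orbit.
    have hsub : ∀ t : ℝ, dilationOp (expPos t) (g - mulSmooth (contDiffOn_log_norm_pow k) (c k)) =
        ∑ j ∈ Finset.range k, ((t : ℂ) ^ j) •
          (c j - (k.choose j : ℂ) • mulSmooth (contDiffOn_log_norm_pow (k - j)) (c k)) := by
      intro t
      rw [map_sub, hg, dilationOp_expPos_mulSmooth_log_pow, hk, ← Finset.sum_sub_distrib,
        Finset.sum_range_succ, mulSmooth_eq_self (contDiffOn_log_norm_pow (k - k)) (by simp),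
        Nat.choose_self, Nat.cast_one, mul_one, sub_self, add_zero]
      exact Finset.sum_congr rfl fun j _ => by rw [smul_sub, smul_smul]
    obtain ⟨h, hh, hsum⟩ := ih _ _ hsub
    refine ⟨Function.update h k (c k), fun j => ?_, ?_⟩
    · rcases eq_or_ne j k with rfl | hj
      · simpa using hk
      · simpa [hj] using hh j
    · rw [Finset.sum_range_succ, Function.update_self, ← sub_eq_iff_eq_add, hsum]
      refine Finset.sum_congr rfl fun j hj => ?_
      rw [Function.update_of_ne (Finset.mem_range.1 hj).ne]

end Dilation

theorem mainTheorem5 (n k : ℕ) (lam : ℂ) (f : ComplexDistribution (puncturedSpace n)) :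
    f ∈ spectralSubspace n k lam ↔
      ∃ h : Fin (k + 1) → ComplexDistribution (puncturedSpace n),
        (∀ j, IsHomogeneousDistribution (h j)) ∧
        f = ComplexDistribution.mulSmooth (contDiffOn_norm_cpow lam)
          (∑ j : Fin (k + 1),
            ComplexDistribution.mulSmooth (contDiffOn_log_norm_pow (j : ℕ)) (h j)) := by
  constructor
  · intro hf
    rw [← mulSmooth_norm_cpow_cancel lam f, mulSmooth_norm_cpow_mem_spectralSubspace] at hf
    obtain ⟨c, hc⟩ := exists_dilationOp_eq_sum hf
    obtain ⟨h, hh, hsum⟩ := exists_homogeneous_log_expansion (k + 1) _ c hc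
    refine ⟨fun j => h j, fun j => hh j, ?_⟩
    rw [Fin.sum_univ_eq_sum_range
      (fun j => ComplexDistribution.mulSmooth (contDiffOn_log_norm_pow j) (h j)), ← hsum,
      mulSmooth_norm_cpow_cancel]
  · rintro ⟨h, hh, rfl⟩
    rw [mulSmooth_norm_cpow_mem_spectralSubspace]
    intro a
    rw [map_sum]
    exact Finset.sum_eq_zero fun j _ => sub_one_pow_mulSmooth_log_pow (hh j) a j _ j.isLt
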